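/- Let $\mathcal H_1,\dots,\mathcal H_n$ be finite-dimensional complex Hilbert spaces with chosen orthonormal bases, let $|\psi\rangle\in\mathcal H_1\otimes\cdots\otimes\mathcal H_n$ be a unit vector, and let $\rho=|\psi\rangle\langle\psi|$ be the associated pure-state density matrix. For a set $I\subseteq\{1,\dots,n\}$ put $\mathcal H_I=\bigotimes_{i\in I}\mathcal H_i$ (factors in increasing order), let $\rho_I=\mathrm{tr}_{I^c}(\rho)$ be the reduced density matrix on $\mathcal H_I$, let $s_I$ be the orthogonal projection onto the image of $\rho_I$, and write $\mathcal O|_{\rho_I}=s_I\mathcal O s_I$ for a linear operator $\mathcal O$ on $\mathcal H_I$. For $k\ge 1$ let $$\Omega^k(\rho)=\prod_{|I|=k}\{\mathcal O|_{\rho_I} : \mathcal O\text{ a linear operator on }\mathcal H_I\}$$ be the space of entanglement $k$-forms, and let $\Omega^0(\rho)=\mathbb C$. For disjoint $I,J$ and operators $A$ on $\mathcal H_I$ and $B$ on $\mathcal H_J$, let $A\,\widehat\otimes\,B$ be the operator on $\mathcal H_{I\cup J}$ obtained from $A\otimes B$ by reordering the tensor factors increasingly and multiplying by the signature of the permutation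 that sorts the concatenation of $I$ and $J$. The entanglement (commutant) complex of $\rho$ is $$0\to\mathbb C\xrightarrow{d^0}\Omega^1(\rho)\xrightarrow{d^1}\cdots\xrightarrow{d^{n-1}}\Omega^n(\rho)\xrightarrow{d^n}0,$$ with $d^0\lambda=(\lambda s_{\{1\}},\dots,\lambda s_{\{n\}})$ and, for $m\ge1$, $$(d^m\omega)_I=\Big(m\sum_{j\in I}\mathbb I_j\,\widehat\otimes\,\omega_{I\setminus\{j\}}\Big)\Big|_{\rho_I},\qquad |I|=m+1.$$ Let $H^k(\rho)=\ker d^k/\operatorname{im}d^{k-1}$ be its cohomology (with $H^0(\rho)=\ker d^0$). Then for every $k$ with $0\le k\le n$, $$\dim_{\mathbb C}H^k(\rho)=\dim_{\mathbb C}H^{n-k}(\rho).$$ -/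

import Mathlib

open scoped TensorProduct

namespace EntanglementCohomology

noncomputable section

/-- Product basis labels `(α_i)_{i ∈ I}` of `H_I = ⨂_{i ∈ I} H_i`, where `dim H_i = d i`. -/
abbrev Idx {n : ℕ} (d : Fin n → ℕ) (I : Finset (Fin n)) : Type := ∀ i : I, Fin (d i)

/-- Product basis labels of the full `n`-partite space `H_1 ⊗ ⋯ ⊗ H_n`. -/
abbrev FullIdx {n : ℕ} (d : Fin n → ℕ) : Type := ∀ i : Fin n, Fin (d i)

/-- Linear operators on `H_I`, given by their matrices in the product basis. -/
abbrev Op {n : ℕ} (d : Fin n → ℕ) (I : Finset (Fin n)) : Type := Matrix (Idx d I) (Idx d I) ℂ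

/-- The coefficients `C_α` of a vector `ψ = ∑_α C_α |α_1⟩ ⊗ ⋯ ⊗ |α_n⟩` in the product of the
orthonormal bases `b i` of the subsystems. The product basis is orthonormal, so the squared norm of
`ψ` is `∑_α |C_α|²`. -/
def stateCoeff {n : ℕ} {d : Fin n → ℕ} {H : Fin n → Type*}
    [∀ i, NormedAddCommGroup (H i)] [∀ i, InnerProductSpace ℂ (H i)]
    (b : ∀ i, OrthonormalBasis (Fin (d i)) ℂ (H i)) (ψ : ⨂[ℂ] i, H i) : FullIdx d → ℂ :=
  fun α => (Basis.piTensorProduct fun i => (b i).toBasis).repr ψ α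

/-- The matrix of `|ψ⟩⟨ψ|`, where `C` are the coefficients of `ψ`. -/
def pureDensity {n : ℕ} {d : Fin n → ℕ} (C : FullIdx d → ℂ) :
    Matrix (FullIdx d) (FullIdx d) ℂ :=
  Matrix.vecMulVec C (star C)

/-- Combine labels on `I` and on its complement to labels on the full system. -/
def glue {n : ℕ} {d : Fin n → ℕ} {I : Finset (Fin n)} (α : Idx d I) (γ : Idx d Iᶜ) : FullIdx d :=
  fun i => if h : i ∈ I then α ⟨i, h⟩ else γ ⟨i, Finset.mem_compl.mpr h⟩

/-- The reduced matrix `ρ_I`: the partial trace of `ρ` over all subsystems outside `I`. -/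
def reduced {n : ℕ} {d : Fin n → ℕ} (ρ : Matrix (FullIdx d) (FullIdx d) ℂ) (I : Finset (Fin n)) :
    Op d I :=
  Matrix.of fun α β => ∑ γ : Idx d Iᶜ, ρ (glue α γ) (glue β γ)

/-- The support projection of a matrix: the orthogonal projection onto its image. -/
def supportProj {m : Type*} [Fintype m] [DecidableEq m] (A : Matrix m m ℂ) : Matrix m m ℂ :=
  Matrix.toEuclideanLin.symm
    ((LinearMap.range (Matrix.toEuclideanLin A)).starProjection.toLinearMap)

/-- The restriction `O ↦ O|_A = s_A O s_A`, with `s_A` the support projection of `A`. -/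
def restriction {m : Type*} [Fintype m] [DecidableEq m] (A : Matrix m m ℂ) :
    Matrix m m ℂ →ₗ[ℂ] Matrix m m ℂ where
  toFun O := supportProj A * O * supportProj A
  map_add' O P := by rw [mul_add, add_mul]
  map_smul' c O := by simp

/-- The space of restricted operators `O|_{ρ_I}` on `H_I`. -/
def restrictedOps {n : ℕ} {d : Fin n → ℕ} (ρ : Matrix (FullIdx d) (FullIdx d) ℂ)
    (I : Finset (Fin n)) : Submodule ℂ (Op d I) :=
  LinearMap.range (restriction (reduced ρ I))

/-- Entanglement `k`-forms: tuples of restricted operators, one on `H_I` for every `k`-element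
set `I` of subsystems. -/
abbrev Form {n : ℕ} {d : Fin n → ℕ} (ρ : Matrix (FullIdx d) (FullIdx d) ℂ) (k : ℕ) : Type :=
  ∀ I : {I : Finset (Fin n) // I.card = k}, restrictedOps ρ I.1

/-- The signature of the permutation that sorts the concatenation of `I` and `J` (each listed
increasingly): the parity of the number of inversions. -/
def shuffleSign {n : ℕ} (I J : Finset (Fin n)) : ℂ :=
  (-1) ^ ((I ×ˢ J).filter fun p => p.2 < p.1).card

/-- Forget the labels outside `I`. -/
def restrictIdx {n : ℕ} {d : Fin n → ℕ} {I K : Finset (Fin n)} (h : I ⊆ K) (α : Idx d K) :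
    Idx d I :=
  fun i => α ⟨i, h i.2⟩

/-- The signed, reordered tensor product `A ⊗̂ B`, an operator on `H_K` with `K = I ∪ J`; it is
zero if `I` and `J` share a subsystem. -/
def hatTensor {n : ℕ} {d : Fin n → ℕ} {I J K : Finset (Fin n)} (h : I ∪ J = K)
    (A : Op d I) (B : Op d J) : Op d K :=
  have hI : I ⊆ K := Finset.union_subset_left h.subset
  have hJ : J ⊆ K := Finset.union_subset_right h.subset
  if Disjoint I J then
    Matrix.of fun α β => shuffleSign I J *
      (A (restrictIdx hI α) (restrictIdx hI β) * B (restrictIdx hJ α) (restrictIdx hJ β))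
  else 0

theorem hatTensor_add {n : ℕ} {d : Fin n → ℕ} {I J K : Finset (Fin n)} (h : I ∪ J = K)
    (A : Op d I) (B B' : Op d J) :
    hatTensor h A (B + B') = hatTensor h A B + hatTensor h A B' := by
  unfold hatTensor
  split_ifs
  · ext α β
    simp [mul_add]
  · simp

theorem hatTensor_smul {n : ℕ} {d : Fin n → ℕ} {I J K : Finset (Fin n)} (h : I ∪ J = K)
    (A : Op d I) (c : ℂ) (B : Op d J) :
    hatTensor h A (c • B) = c • hatTensor h A B := by
  unfold hatTensor
  split_ifs
  · ext α β
    simp only [Matrix.smul_apply, Matrix.of_apply, smul_eq_mul]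
    ring
  · simp

theorem singleton_union_erase {n : ℕ} {I : Finset (Fin n)} {j : Fin n} (hj : j ∈ I) :
    {j} ∪ I.erase j = I := by
  rw [Finset.singleton_union, Finset.insert_erase hj]

theorem card_erase_eq {n k : ℕ} {I : Finset (Fin n)} (hI : I.card = k + 1) {j : Fin n}
    (hj : j ∈ I) : (I.erase j).card = k := by
  rw [Finset.card_erase_of_mem hj, hI, Nat.add_sub_cancel]

/-- The sum `∑_{j ∈ I} 𝕀_j ⊗̂ ω_{I ∖ j}` for a `k`-form `ω` and a `(k+1)`-element set `I`. -/
def identitySum {n : ℕ} {d : Fin n → ℕ} (ρ : Matrix (FullIdx d) (FullIdx d) ℂ) (k : ℕ)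
    (I : {I : Finset (Fin n) // I.card = k + 1}) : Form ρ k →ₗ[ℂ] Op d I.1 where
  toFun ω := ∑ j : I.1, hatTensor (singleton_union_erase j.2) (1 : Op d {j.1})
    (ω ⟨I.1.erase j.1, card_erase_eq I.2 j.2⟩ : Op d (I.1.erase j.1))
  map_add' ω η := by
    simp [hatTensor_add, Finset.sum_add_distrib]
  map_smul' c ω := by
    simp [hatTensor_smul, Finset.smul_sum]

/-- The coboundary of a `k`-form for `k ≥ 1`: the tuple with components
`(k ∑_{j ∈ I} 𝕀_j ⊗̂ ω_{I ∖ j})|_{ρ_I}`, `|I| = k + 1`. -/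
def formCoboundary {n : ℕ} {d : Fin n → ℕ} (ρ : Matrix (FullIdx d) (FullIdx d) ℂ) (k : ℕ) :
    Form ρ k →ₗ[ℂ] Form ρ (k + 1) :=
  LinearMap.pi fun I =>
    (restriction (reduced ρ I.1)).rangeRestrict ∘ₗ ((k : ℂ) • identitySum ρ k I)

/-- The coboundary of scalars: `λ ↦ (λ s_1, …, λ s_n)`, written as the restriction of `λ 𝕀_i`
to the image of `ρ_i`. -/
def scalarCoboundary {n : ℕ} {d : Fin n → ℕ} (ρ : Matrix (FullIdx d) (FullIdx d) ℂ) :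
    ℂ →ₗ[ℂ] Form ρ 1 :=
  LinearMap.pi fun I =>
    (restriction (reduced ρ I.1)).rangeRestrict ∘ₗ LinearMap.toSpanSingleton ℂ _ (1 : Op d I.1)

/-- A support projection is idempotent. -/
theorem supportProj_mul_self {m : Type*} [Fintype m] [DecidableEq m] (A : Matrix m m ℂ) :
    supportProj A * supportProj A = supportProj A := by
  apply Matrix.toEuclideanLin.injective
  have hmul : ∀ M N : Matrix m m ℂ, Matrix.toEuclideanLin (M * N) =
      Matrix.toEuclideanLin M ∘ₗ Matrix.toEuclideanLin N := by
    intro M N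
    ext x i
    simp [Matrix.toLpLin_apply, Matrix.mulVec_mulVec]
  rw [hmul]
  ext1 x
  have hid := Submodule.isIdempotentElem_starProjection (LinearMap.range (Matrix.toEuclideanLin A))
  simpa [supportProj] using DFunLike.congr_fun hid.eq x

/-- The components of `d⁰ λ` are `λ s_i`. -/
theorem scalarCoboundary_apply {n : ℕ} {d : Fin n → ℕ} (ρ : Matrix (FullIdx d) (FullIdx d) ℂ)
    (z : ℂ) (I : {I : Finset (Fin n) // I.card = 1}) :
    (scalarCoboundary ρ z I : Op d I.1) = z • supportProj (reduced ρ I.1) := by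
  change supportProj (reduced ρ I.1) * (z • (1 : Op d I.1)) * supportProj (reduced ρ I.1) = _
  simp [supportProj_mul_self]

/-- The spaces of the entanglement complex `0 → ℂ → Ω¹(ρ) → Ω²(ρ) → ⋯ → Ωⁿ(ρ) → 0`;
for degrees above `n` there is no index set, so the space is zero. -/
def Cochain {n : ℕ} {d : Fin n → ℕ} (ρ : Matrix (FullIdx d) (FullIdx d) ℂ) : ℕ → Type
  | 0 => ℂ
  | k + 1 => Form ρ (k + 1)

instance instAddCommGroupCochain {n : ℕ} {d : Fin n → ℕ} (ρ : Matrix (FullIdx d) (FullIdx d) ℂ) :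
    ∀ k, AddCommGroup (Cochain ρ k)
  | 0 => inferInstanceAs (AddCommGroup ℂ)
  | k + 1 => inferInstanceAs (AddCommGroup (Form ρ (k + 1)))

instance instModuleCochain {n : ℕ} {d : Fin n → ℕ} (ρ : Matrix (FullIdx d) (FullIdx d) ℂ) :
    ∀ k, Module ℂ (Cochain ρ k)
  | 0 => inferInstanceAs (Module ℂ ℂ)
  | k + 1 => inferInstanceAs (Module ℂ (Form ρ (k + 1)))

/-- The coboundary operators of the entanglement complex. -/
def coboundary {n : ℕ} {d : Fin n → ℕ} (ρ : Matrix (FullIdx d) (FullIdx d) ℂ) :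
    ∀ k, Cochain ρ k →ₗ[ℂ] Cochain ρ (k + 1)
  | 0 => scalarCoboundary ρ
  | k + 1 => formCoboundary ρ (k + 1)

/-- The image of the incoming coboundary operator in degree `k` (zero for `k = 0`). -/
def coboundaries {n : ℕ} {d : Fin n → ℕ} (ρ : Matrix (FullIdx d) (FullIdx d) ℂ) :
    ∀ k, Submodule ℂ (Cochain ρ k)
  | 0 => ⊥
  | k + 1 => LinearMap.range (coboundary ρ k)

/-- The entanglement cohomology `Hᵏ(ρ) = ker dᵏ / im dᵏ⁻¹`. -/
abbrev Cohomology {n : ℕ} {d : Fin n → ℕ} (ρ : Matrix (FullIdx d) (FullIdx d) ℂ) (k : ℕ) : Type :=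
  LinearMap.ker (coboundary ρ k) ⧸ (coboundaries ρ k).submoduleOf (LinearMap.ker (coboundary ρ k))

end

end EntanglementCohomology

/-! The complex is dual to itself. For ω of degree k and η of degree n − k put ⟨ω, η⟩ = ∑_I ± ⟨ψ|
ω_I ⊗ η_{Iᶜ} |ψ⟩, a bilinear pairing.

It is nondegenerate (`cochainPairing_injective`): if M is the coefficient matrix of ψ for the
splitting I | Iᶜ, then ρ_I = M M† and ⟨ψ|A ⊗ B|ψ⟩ = ∑ (M† A M)_{γγ'} B_{γγ'}. If this vanishes for
all B, then M† A M = 0, hence s_I A s_I = 0.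

Since s_I ⊗ 𝕀 fixes ψ, the pairing does not see restrictions, so d may be replaced by the
unrestricted signed sum δ. Moving one index j from I to Iᶜ then shows that dᵏ and dⁿ⁻ᵏ⁻¹ are
transposes of each other up to a scalar (`exists_cochainPairing_coboundary`). Hence Ωᵏ and Ωⁿ⁻ᵏ have
equal dimension, dᵏ and dⁿ⁻ᵏ⁻¹ have equal rank, and d² = 0 follows from δ² = 0. The claim is then
dim Hᵏ = dim Ωᵏ − rank dᵏ − rank dᵏ⁻¹. -/

open scoped Kronecker ComplexOrder

namespace EntanglementCohomology

noncomputable section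

/-! ### Support projections of matrices of the form M M† -/

section SupportProjection

variable {m p : Type*} [Fintype m] [DecidableEq m] [Fintype p]

theorem toEuclideanLin_supportProj (A : Matrix m m ℂ) :
    Matrix.toEuclideanLin (supportProj A) =
      ((LinearMap.range (Matrix.toEuclideanLin A)).starProjection.toLinearMap) := by
  simp [supportProj]

theorem supportProj_conjTranspose (A : Matrix m m ℂ) :
    (supportProj A).conjTranspose = supportProj A := by
  apply Matrix.toEuclideanLin.injective
  rw [Matrix.toEuclideanLin_conjTranspose_eq_adjoint, toEuclideanLin_supportProj]
  exact (LinearMap.isSymmetric_iff_isSelfAdjoint _).1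
    (LinearMap.range (Matrix.toEuclideanLin A)).starProjection_isSymmetric

theorem supportProj_mul (A : Matrix m m ℂ) : supportProj A * A = A := by
  apply Matrix.toEuclideanLin.injective
  ext1 x
  have h : Matrix.toEuclideanLin (supportProj A * A) x =
      Matrix.toEuclideanLin (supportProj A) (Matrix.toEuclideanLin A x) := by
    simp [Matrix.toLpLin_apply, Matrix.mulVec_mulVec]
  rw [h, toEuclideanLin_supportProj]
  exact Submodule.starProjection_eq_self_iff.2 (LinearMap.mem_range_self _ x)

theorem exists_mul_eq_supportProj (A : Matrix m m ℂ) : ∃ X, A * X = supportProj A := by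
  have h : ∀ j, ∃ v, A.mulVec v = (supportProj A).col j := by
    intro j
    have hj : Matrix.toEuclideanLin (supportProj A) (EuclideanSpace.single j 1) ∈
        LinearMap.range (Matrix.toEuclideanLin A) := by
      rw [toEuclideanLin_supportProj]
      exact Submodule.starProjection_apply_mem _ _
    obtain ⟨x, hx⟩ := hj
    refine ⟨WithLp.ofLp x, ?_⟩
    have := congrArg WithLp.ofLp hx
    simpa [Matrix.toLpLin_apply] using this
  choose v hv using h
  refine ⟨Matrix.of fun i j => v j i, ?_⟩
  ext i j
  exact congrFun (hv j) i

/-- M and M M† have the same left annihilators, and s − 1 annihilates M M†. -/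
theorem supportProj_mul_factor (M : Matrix m p ℂ) :
    supportProj (M * M.conjTranspose) * M = M := by
  have h : (supportProj (M * M.conjTranspose) - 1) * (M * M.conjTranspose) = 0 := by
    rw [sub_mul, supportProj_mul, one_mul, sub_self]
  rw [Matrix.mul_self_mul_conjTranspose_eq_zero, Matrix.sub_mul, Matrix.one_mul,
    sub_eq_zero] at h
  exact h

/-- Writing s = M M† X = X† M M† exhibits M† O M as a factor inside s O s. -/
theorem restriction_eq_zero_of_factor (M : Matrix m p ℂ) (O : Matrix m m ℂ)
    (h : M.conjTranspose * O * M = 0) : restriction (M * M.conjTranspose) O = 0 := by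
  obtain ⟨X, hX⟩ := exists_mul_eq_supportProj (M * M.conjTranspose)
  have hX' : X.conjTranspose * (M * M.conjTranspose) = supportProj (M * M.conjTranspose) := by
    rw [← supportProj_conjTranspose, ← hX]
    simp [Matrix.conjTranspose_mul]
  calc restriction (M * M.conjTranspose) O
      = (X.conjTranspose * (M * M.conjTranspose)) * O * ((M * M.conjTranspose) * X) := by
        rw [hX, hX']; rfl
    _ = X.conjTranspose * M * (M.conjTranspose * O * M) * M.conjTranspose * X := by
        simp only [Matrix.mul_assoc]
    _ = 0 := by rw [h]; simp

theorem restriction_eq_self_of_mem_range {A O : Matrix m m ℂ}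
    (h : O ∈ LinearMap.range (restriction A)) : restriction A O = O := by
  obtain ⟨P, rfl⟩ := h
  change supportProj A * (supportProj A * P * supportProj A) * supportProj A =
    supportProj A * P * supportProj A
  rw [← Matrix.mul_assoc, ← Matrix.mul_assoc, supportProj_mul_self, Matrix.mul_assoc,
    supportProj_mul_self]

end SupportProjection

/-! ### Shuffle signs -/

section Signs

variable {n : ℕ}

theorem shuffleSign_eq_prod (I J : Finset (Fin n)) :
    shuffleSign I J = ∏ i ∈ I, ∏ j ∈ J, if j < i then (-1 : ℂ) else 1 := by
  rw [shuffleSign, ← Finset.prod_product', Finset.prod_ite]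
  simp

theorem shuffleSign_insert_left {I : Finset (Fin n)} {i : Fin n} (hi : i ∉ I)
    (J : Finset (Fin n)) :
    shuffleSign (insert i I) J = shuffleSign {i} J * shuffleSign I J := by
  simp [shuffleSign_eq_prod, Finset.prod_insert hi]

theorem shuffleSign_insert_right (I : Finset (Fin n)) {J : Finset (Fin n)} {j : Fin n}
    (hj : j ∉ J) :
    shuffleSign I (insert j J) = shuffleSign I {j} * shuffleSign I J := by
  simp only [shuffleSign_eq_prod, Finset.prod_insert hj, Finset.prod_mul_distrib,
    Finset.prod_singleton]

/-- Each i ∈ J is an inversion with j in exactly one of the two orders. -/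
theorem shuffleSign_singleton_comm {J : Finset (Fin n)} {j : Fin n} (hj : j ∉ J) :
    shuffleSign {j} J = (-1) ^ J.card * shuffleSign J {j} := by
  rw [shuffleSign_eq_prod, shuffleSign_eq_prod, ← Finset.prod_const, Finset.prod_singleton,
    ← Finset.prod_mul_distrib]
  refine Finset.prod_congr rfl fun i hi => ?_
  have hne : i ≠ j := fun h => hj (h ▸ hi)
  rcases lt_or_gt_of_ne hne with h | h
  · simp [h, h.not_gt]
  · simp [h, h.not_gt]

theorem shuffleSign_mul_self (I J : Finset (Fin n)) : shuffleSign I J * shuffleSign I J = 1 := by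
  rw [shuffleSign, ← mul_pow]
  simp

theorem shuffleSign_ne_zero (I J : Finset (Fin n)) : shuffleSign I J ≠ 0 :=
  left_ne_zero_of_mul_eq_one (shuffleSign_mul_self I J)

/-- The sign rule behind adjointness of δ: j moves from the left block to the right one. -/
theorem shuffleSign_insert_mul {J K : Finset (Fin n)} {j : Fin n} (hJ : j ∉ J) (hK : j ∉ K) :
    shuffleSign (insert j J) K * shuffleSign {j} J =
      (-1) ^ J.card * (shuffleSign J (insert j K) * shuffleSign {j} K) := by
  rw [shuffleSign_insert_left hJ, shuffleSign_insert_right J hK, shuffleSign_singleton_comm hJ]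
  ring

/-- The sign rule behind δ² = 0. -/
theorem shuffleSign_singleton_insert_swap {K : Finset (Fin n)} {j l : Fin n} (hjl : j ≠ l)
    (hj : j ∉ K) (hl : l ∉ K) :
    shuffleSign {j} (insert l K) * shuffleSign {l} K =
      -(shuffleSign {l} (insert j K) * shuffleSign {j} K) := by
  rw [shuffleSign_insert_right _ hj, shuffleSign_insert_right _ hl,
    shuffleSign_singleton_comm (J := {l}) (j := j) (by simpa using hjl)]
  simp
  ring

end Signs

/-! ### Local operators as operators on the full system -/

section Extension

variable {n : ℕ} {d : Fin n → ℕ}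

/-- Restrict labels of the full system to `I`. -/
def restrictFull (I : Finset (Fin n)) (α : FullIdx d) : Idx d I := fun i => α i

theorem restrictFull_eq_iff (I : Finset (Fin n)) (α β : FullIdx d) :
    restrictFull I α = restrictFull I β ↔ ∀ i ∈ I, α i = β i := by
  simp [restrictFull, funext_iff]

/-- Split labels of the full system into labels on `I` and on its complement. -/
def splitIdx (I : Finset (Fin n)) : FullIdx d ≃ Idx d I × Idx d Iᶜ where
  toFun α := (restrictFull I α, restrictFull Iᶜ α)
  invFun p := glue p.1 p.2
  left_inv α := by
    funext i
    simp [glue, restrictFull]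
  right_inv p := by
    refine Prod.ext ?_ ?_
    · funext i
      simp [glue, restrictFull]
    · funext i
      have hi : (i : Fin n) ∉ I := Finset.mem_compl.1 i.2
      simp [glue, restrictFull, hi]

/-- The operator `A ⊗ 𝕀` on the full system, for an operator `A` on `H_I`. -/
def extend (I : Finset (Fin n)) : Op d I →ₗ[ℂ] Matrix (FullIdx d) (FullIdx d) ℂ where
  toFun A := (A ⊗ₖ (1 : Op d Iᶜ)).submatrix (splitIdx I) (splitIdx I)
  map_add' A B := by rw [Matrix.add_kronecker]; rfl
  map_smul' c A := by rw [Matrix.smul_kronecker]; rfl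

theorem extend_apply (I : Finset (Fin n)) (A : Op d I) (α β : FullIdx d) :
    extend I A α β = A (restrictFull I α) (restrictFull I β) *
      if ∀ i ∉ I, α i = β i then 1 else 0 := by
  have h : (∀ i ∉ I, α i = β i) ↔ restrictFull Iᶜ α = restrictFull Iᶜ β := by
    simp [restrictFull_eq_iff]
  simp only [h]
  rfl

theorem extend_apply_splitIdx_symm (I : Finset (Fin n)) (A : Op d I) (α : FullIdx d)
    (β : Idx d I) (γ : Idx d Iᶜ) :
    extend I A α ((splitIdx I).symm (β, γ)) =
      A (restrictFull I α) β * (1 : Op d Iᶜ) (restrictFull Iᶜ α) γ := by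
  simp only [extend, LinearMap.coe_mk, AddHom.coe_mk]
  rw [Matrix.submatrix_apply, Equiv.apply_symm_apply]
  rfl

theorem extend_compl (I : Finset (Fin n)) (B : Op d Iᶜ) :
    extend Iᶜ B = ((1 : Op d I) ⊗ₖ B).submatrix (splitIdx I) (splitIdx I) := by
  ext α β
  have h : (∀ i ∉ Iᶜ, α i = β i) ↔ restrictFull I α = restrictFull I β := by
    simp [restrictFull_eq_iff]
  rw [extend_apply, mul_comm]
  simp only [h]
  rfl

theorem extend_one (I : Finset (Fin n)) : extend I (1 : Op d I) = 1 := by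
  simp [extend]

theorem extend_mul (I : Finset (Fin n)) (A B : Op d I) :
    extend I (A * B) = extend I A * extend I B := by
  simp only [extend, LinearMap.coe_mk, AddHom.coe_mk]
  rw [Matrix.submatrix_mul_equiv, ← Matrix.mul_kronecker_mul, one_mul]

theorem extend_conjTranspose (I : Finset (Fin n)) (A : Op d I) :
    (extend I A).conjTranspose = extend I A.conjTranspose := by
  simp only [extend, LinearMap.coe_mk, AddHom.coe_mk]
  rw [Matrix.conjTranspose_submatrix, Matrix.conjTranspose_kronecker, Matrix.conjTranspose_one]

theorem extend_mul_extend_compl (I : Finset (Fin n)) (A : Op d I) (B : Op d Iᶜ) :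
    extend I A * extend Iᶜ B = (A ⊗ₖ B).submatrix (splitIdx I) (splitIdx I) := by
  rw [extend_compl]
  simp only [extend, LinearMap.coe_mk, AddHom.coe_mk]
  rw [Matrix.submatrix_mul_equiv, ← Matrix.mul_kronecker_mul, one_mul, mul_one]

theorem extend_commute {I J : Finset (Fin n)} (hIJ : J = Iᶜ) (A : Op d I) (B : Op d J) :
    extend I A * extend J B = extend J B * extend I A := by
  subst hIJ
  rw [extend_mul_extend_compl, extend_compl]
  simp only [extend, LinearMap.coe_mk, AddHom.coe_mk]
  rw [Matrix.submatrix_mul_equiv, ← Matrix.mul_kronecker_mul, one_mul, mul_one]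

theorem extend_injective [Nonempty (FullIdx d)] (I : Finset (Fin n)) :
    Function.Injective (extend (d := d) I) := by
  intro A B h
  obtain ⟨γ⟩ := ‹Nonempty (FullIdx d)›
  ext α β
  have := congrFun₂ h ((splitIdx I).symm (α, restrictFull Iᶜ γ))
    ((splitIdx I).symm (β, restrictFull Iᶜ γ))
  simpa [extend] using this

/-- On the full system the factor 𝕀_j is absorbed by the extension, so the coboundary becomes a mere
signed sum. -/
theorem extend_hatTensor_one {I : Finset (Fin n)} {j : Fin n} (hj : j ∈ I)
    (A : Op d (I.erase j)) :
    extend I (hatTensor (singleton_union_erase hj) (1 : Op d {j}) A) =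
      shuffleSign {j} (I.erase j) • extend (I.erase j) A := by
  ext α β
  have hdisj : Disjoint {j} (I.erase j) := by simp
  rw [extend_apply, Matrix.smul_apply, extend_apply, hatTensor, if_pos hdisj, Matrix.of_apply]
  change shuffleSign {j} (I.erase j) * ((1 : Op d {j}) (restrictFull {j} α) (restrictFull {j} β) *
    A (restrictFull (I.erase j) α) (restrictFull (I.erase j) β)) * _ = _
  have h1 : (1 : Op d {j}) (restrictFull {j} α) (restrictFull {j} β) =
      if α j = β j then 1 else 0 := by
    rw [Matrix.one_apply]
    simp [restrictFull_eq_iff]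
  have h2 : (∀ i ∉ I.erase j, α i = β i) ↔ α j = β j ∧ ∀ i ∉ I, α i = β i := by
    constructor
    · intro h
      exact ⟨h j (by simp), fun i hi => h i (by simp [hi])⟩
    · rintro ⟨h, h'⟩ i hi
      by_cases hij : i = j
      · exact hij ▸ h
      · exact h' i (by simpa [hij] using hi)
  rw [h1]
  simp only [h2, ite_and, smul_eq_mul]
  split_ifs <;> ring

end Extension

/-! ### Expectation values in the state ψ and nondegeneracy -/

section PureState

variable {n : ℕ} {d : Fin n → ℕ} (C : FullIdx d → ℂ)

/-- The coefficients of a vector as a matrix with rows labelled by `I` and columns by its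
complement. -/
def coeffMatrix (I : Finset (Fin n)) : Matrix (Idx d I) (Idx d Iᶜ) ℂ :=
  Matrix.of fun α γ => C ((splitIdx I).symm (α, γ))

theorem reduced_pureDensity (I : Finset (Fin n)) :
    reduced (pureDensity C) I = coeffMatrix C I * (coeffMatrix C I).conjTranspose := by
  ext α β
  rfl

/-- The support projection of `ρ_I`, for the pure state with coefficients `C`. -/
abbrev suppProj (I : Finset (Fin n)) : Op d I := supportProj (reduced (pureDensity C) I)

/-- This is s_I M = M, read entrywise. -/
theorem extend_suppProj_mulVec (I : Finset (Fin n)) : (extend I (suppProj C I)).mulVec C = C := by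
  funext α
  have h : suppProj C I * coeffMatrix C I = coeffMatrix C I := by
    rw [suppProj, reduced_pureDensity, supportProj_mul_factor]
  have h' := congrFun₂ h (restrictFull I α) (restrictFull Iᶜ α)
  have hα : (splitIdx I).symm (restrictFull I α, restrictFull Iᶜ α) = α :=
    (splitIdx I).symm_apply_apply α
  rw [Matrix.mul_apply] at h'
  simp only [coeffMatrix, Matrix.of_apply, hα] at h'
  rw [Matrix.mulVec, dotProduct, ← (splitIdx I).symm.sum_comp, Fintype.sum_prod_type, ← h']
  refine Finset.sum_congr rfl fun β _ => ?_
  rw [Finset.sum_eq_single (restrictFull Iᶜ α)]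
  · rw [extend_apply_splitIdx_symm, Matrix.one_apply_eq, mul_one]
  · intro γ _ hγ
    rw [extend_apply_splitIdx_symm, Matrix.one_apply_ne hγ.symm, mul_zero, zero_mul]
  · simp

/-- The expectation value `⟨ψ|X|ψ⟩`. -/
def expect : Matrix (FullIdx d) (FullIdx d) ℂ →ₗ[ℂ] ℂ where
  toFun X := star C ⬝ᵥ X.mulVec C
  map_add' X Y := by rw [Matrix.add_mulVec, dotProduct_add]
  map_smul' c X := by rw [Matrix.smul_mulVec, dotProduct_smul]; rfl

theorem expect_mul_of_mulVec {X Y : Matrix (FullIdx d) (FullIdx d) ℂ} (h : Y.mulVec C = C) :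
    expect C (X * Y) = expect C X := by
  simp [expect, ← Matrix.mulVec_mulVec, h]

theorem expect_mul_of_conjTranspose_mulVec {X Y : Matrix (FullIdx d) (FullIdx d) ℂ}
    (h : Y.conjTranspose.mulVec C = C) : expect C (Y * X) = expect C X := by
  have h' := Matrix.star_mulVec Y.conjTranspose C
  rw [Matrix.conjTranspose_conjTranspose, h] at h'
  simp only [expect, LinearMap.coe_mk, AddHom.coe_mk]
  rw [← Matrix.mulVec_mulVec, Matrix.dotProduct_mulVec, ← h']

/-- The right projection commutes past B and is absorbed by |ψ⟩; the left one, being self-adjoint,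
is absorbed by ⟨ψ|. -/
theorem expect_restriction_mul {I J : Finset (Fin n)} (hIJ : J = Iᶜ) (A : Op d I)
    (B : Op d J) :
    expect C (extend I (restriction (reduced (pureDensity C) I) A) * extend J B) =
      expect C (extend I A * extend J B) := by
  change expect C (extend I (suppProj C I * A * suppProj C I) * extend J B) = _
  rw [extend_mul, extend_mul, Matrix.mul_assoc, extend_commute hIJ, ← Matrix.mul_assoc,
    expect_mul_of_mulVec C (extend_suppProj_mulVec C I), Matrix.mul_assoc,
    expect_mul_of_conjTranspose_mulVec]
  rw [extend_conjTranspose, supportProj_conjTranspose, extend_suppProj_mulVec]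

theorem expect_mul_restriction {I J : Finset (Fin n)} (hIJ : J = Iᶜ) (A : Op d I)
    (B : Op d J) :
    expect C (extend I A * extend J (restriction (reduced (pureDensity C) J) B)) =
      expect C (extend I A * extend J B) := by
  have hJI : I = Jᶜ := by rw [hIJ, compl_compl]
  rw [extend_commute hIJ, expect_restriction_mul C hJI, extend_commute hIJ]

theorem expect_extend_mul (I : Finset (Fin n)) (A : Op d I) (B : Op d Iᶜ) :
    expect C (extend I A * extend Iᶜ B) =
      ∑ γ, ∑ γ', ((coeffMatrix C I).conjTranspose * A * coeffMatrix C I) γ γ' * B γ γ' := by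
  have hexp : expect C (extend I A * extend Iᶜ B) =
      ∑ γ, ∑ α, ∑ γ', ∑ α', star (coeffMatrix C I α γ) * (A α α' * B γ γ' *
        coeffMatrix C I α' γ') := by
    rw [extend_mul_extend_compl]
    simp only [expect, LinearMap.coe_mk, AddHom.coe_mk]
    rw [dotProduct, ← (splitIdx I).symm.sum_comp, Fintype.sum_prod_type_right]
    refine Finset.sum_congr rfl fun γ _ => Finset.sum_congr rfl fun α _ => ?_
    rw [Matrix.mulVec, dotProduct, ← (splitIdx I).symm.sum_comp, Fintype.sum_prod_type_right,
      Finset.mul_sum]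
    refine Finset.sum_congr rfl fun γ' _ => ?_
    rw [Finset.mul_sum]
    refine Finset.sum_congr rfl fun α' _ => ?_
    rw [Matrix.submatrix_apply, Equiv.apply_symm_apply, Equiv.apply_symm_apply]
    rfl
  rw [hexp]
  refine Finset.sum_congr rfl fun γ _ => ?_
  rw [Finset.sum_comm]
  refine Finset.sum_congr rfl fun γ' _ => ?_
  rw [Finset.sum_comm, Matrix.mul_apply, Finset.sum_mul]
  refine Finset.sum_congr rfl fun α' _ => ?_
  rw [Matrix.mul_apply, Finset.sum_mul, Finset.sum_mul]
  refine Finset.sum_congr rfl fun α _ => ?_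
  rw [Matrix.conjTranspose_apply]
  ring

theorem restriction_eq_zero_of_expect (I : Finset (Fin n)) (A : Op d I)
    (h : ∀ B : Op d Iᶜ, expect C (extend I A * extend Iᶜ B) = 0) :
    restriction (reduced (pureDensity C) I) A = 0 := by
  rw [reduced_pureDensity]
  apply restriction_eq_zero_of_factor
  ext γ γ'
  -- Testing against a matrix unit isolates one entry of M† A M.
  have hB := h (Matrix.single γ γ' 1)
  rw [expect_extend_mul, Finset.sum_eq_single γ, Finset.sum_eq_single γ'] at hB
  · simpa using hB
  · intro x _ hx
    simp [hx.symm]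
  · simp
  · intro x _ hx
    simp [hx.symm]
  · simp

/-- Restricted test operators suffice, because restricting B does not change the expectation value.
-/
theorem eq_zero_of_expect {I J : Finset (Fin n)} (hIJ : J = Iᶜ) {A : Op d I}
    (hA : A ∈ restrictedOps (pureDensity C) I)
    (h : ∀ B ∈ restrictedOps (pureDensity C) J, expect C (extend I A * extend J B) = 0) :
    A = 0 := by
  subst hIJ
  rw [← restriction_eq_self_of_mem_range hA]
  refine restriction_eq_zero_of_expect C I A fun B => ?_
  rw [← h _ (LinearMap.mem_range_self _ B), expect_mul_restriction C rfl]

instance uniqueIdxEmpty : Unique (Idx d (∅ : Finset (Fin n))) where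
  default := fun i => absurd i.2 (Finset.notMem_empty _)
  uniq _ := funext fun i => absurd i.2 (Finset.notMem_empty _)

variable {C}

/-- `H_∅` is one-dimensional, and the scalar s_∅ satisfies s_∅ C_α = C_α for some C_α ≠ 0. Thus Ω⁰ =
ℂ fits the pattern of the higher degrees, with I = ∅. -/
theorem suppProj_empty (hC : C ≠ 0) : suppProj C ∅ = 1 := by
  obtain ⟨α, hα⟩ := Function.ne_iff.1 hC
  have h : suppProj C ∅ * coeffMatrix C ∅ = coeffMatrix C ∅ := by
    rw [suppProj, reduced_pureDensity, supportProj_mul_factor]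
  have h' := congrFun₂ h (restrictFull ∅ α) (restrictFull ∅ᶜ α)
  have hα' : (splitIdx ∅).symm (restrictFull ∅ α, restrictFull ∅ᶜ α) = α :=
    (splitIdx ∅).symm_apply_apply α
  rw [Matrix.mul_apply, Fintype.sum_unique, Subsingleton.elim default (restrictFull ∅ α)] at h'
  simp only [coeffMatrix, Matrix.of_apply, hα'] at h'
  ext x y
  rw [Subsingleton.elim x (restrictFull ∅ α), Subsingleton.elim y (restrictFull ∅ α),
    Matrix.one_apply_eq]
  exact (mul_eq_right₀ hα).1 h'

theorem smul_one_mem_restrictedOps_empty (hC : C ≠ 0) (z : ℂ) :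
    z • (1 : Op d ∅) ∈ restrictedOps (pureDensity C) ∅ := by
  refine ⟨z • 1, ?_⟩
  change suppProj C ∅ * (z • 1) * suppProj C ∅ = _
  rw [suppProj_empty hC, one_mul, mul_one]

theorem eq_smul_one_of_op_empty (A : Op d (∅ : Finset (Fin n))) :
    A = A default default • (1 : Op d ∅) := by
  ext x y
  rw [Subsingleton.elim x default, Subsingleton.elim y default]
  simp

end PureState

/-! ### The unrestricted signed sum δ and its adjointness -/

section OperatorFamilies

variable {n : ℕ} (d : Fin n → ℕ)

/-- Families of operators on the full system, indexed by sets of subsystems. -/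
abbrev OpFamily : Type := Finset (Fin n) → Matrix (FullIdx d) (FullIdx d) ℂ

/-- The signed sum `(δ f)_I = ∑_{j ∈ I} ± f_{I ∖ j}` underlying the coboundary operators. -/
def signedSum : OpFamily d →ₗ[ℂ] OpFamily d where
  toFun f I := ∑ j ∈ I, shuffleSign {j} (I.erase j) • f (I.erase j)
  map_add' f g := by
    funext I
    simp [Finset.sum_add_distrib]
  map_smul' c f := by
    funext I
    simp only [Pi.smul_apply, RingHom.id_apply, Finset.smul_sum]
    exact Finset.sum_congr rfl fun j _ => smul_comm _ _ _

variable {d}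

theorem signedSum_apply (f : OpFamily d) (I : Finset (Fin n)) :
    signedSum d f I = ∑ j ∈ I, shuffleSign {j} (I.erase j) • f (I.erase j) := rfl

theorem signedSum_signedSum (f : OpFamily d) : signedSum d (signedSum d f) = 0 := by
  funext I
  simp only [signedSum_apply, Finset.smul_sum, Pi.zero_apply]
  rw [Finset.sum_sigma']
  -- Removing j then l, or l then j, gives the same operator with opposite signs.
  refine Finset.sum_involution (fun p _ => ⟨p.2, p.1⟩) ?_ ?_ ?_ ?_
  · rintro ⟨j, l⟩ h
    simp only [Finset.mem_sigma, Finset.mem_erase] at h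
    obtain ⟨hj, hlj, hl⟩ := h
    have h1 : I.erase j = insert l ((I.erase j).erase l) :=
      (Finset.insert_erase (Finset.mem_erase.2 ⟨hlj, hl⟩)).symm
    have h2 : I.erase l = insert j ((I.erase j).erase l) := by
      rw [Finset.erase_right_comm]
      exact (Finset.insert_erase (Finset.mem_erase.2 ⟨hlj.symm, hj⟩)).symm
    have h3 : (I.erase l).erase j = (I.erase j).erase l := Finset.erase_right_comm
    have hs := shuffleSign_singleton_insert_swap (K := (I.erase j).erase l) hlj.symm
      (by simp) (by simp)
    rw [← h1, ← h2] at hs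
    simp only [h3, smul_smul]
    rw [← add_smul, hs, neg_add_cancel, zero_smul]
  · rintro ⟨j, l⟩ h - heq
    simp only [Finset.mem_sigma, Finset.mem_erase] at h
    exact h.2.1 (congrArg Sigma.fst heq)
  · rintro ⟨j, l⟩ h
    simp only [Finset.mem_sigma, Finset.mem_erase] at h ⊢
    exact ⟨h.2.2, h.2.1.symm, h.1⟩
  · rintro ⟨j, l⟩ h
    rfl

/-- The signed pairing `∑_I ± ⟨ψ| f_I g_{Iᶜ} |ψ⟩` of operator families. -/
def pairing (C : FullIdx d → ℂ) : OpFamily d →ₗ[ℂ] OpFamily d →ₗ[ℂ] ℂ :=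
  LinearMap.mk₂ ℂ (fun f g => ∑ I, shuffleSign I Iᶜ * expect C (f I * g Iᶜ))
    (by intro f f' g; simp [add_mul, mul_add, Finset.sum_add_distrib])
    (by
      intro c f g
      simp only [Pi.smul_apply, smul_mul_assoc, map_smul, smul_eq_mul, Finset.mul_sum]
      exact Finset.sum_congr rfl fun I _ => mul_left_comm _ _ _)
    (by intro f g g'; simp [mul_add, Finset.sum_add_distrib])
    (by
      intro c f g
      simp only [Pi.smul_apply, mul_smul_comm, map_smul, smul_eq_mul, Finset.mul_sum]
      exact Finset.sum_congr rfl fun I _ => mul_left_comm _ _ _)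

theorem pairing_apply (C : FullIdx d → ℂ) (f g : OpFamily d) :
    pairing C f g = ∑ I, shuffleSign I Iᶜ * expect C (f I * g Iᶜ) := rfl

/-- Both sides sum over pairs: (I, j) with j ∈ I on the left, (J, j) with j ∉ J on the right. The
substitution J = I ∖ j matches the operators, and `shuffleSign_insert_mul` the signs. -/
theorem pairing_signedSum (C : FullIdx d → ℂ) (f g : OpFamily d) :
    pairing C (signedSum d f) g =
      pairing C (fun I => (-1 : ℂ) ^ I.card • f I) (signedSum d g) := by
  simp only [pairing_apply, signedSum_apply, Finset.sum_mul, Finset.mul_sum, map_sum]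
  rw [Finset.sum_sigma', Finset.sum_sigma']
  refine Finset.sum_bij' (fun p _ => ⟨p.1.erase p.2, p.2⟩) (fun p _ => ⟨insert p.2 p.1, p.2⟩)
    ?_ ?_ ?_ ?_ ?_
  · rintro ⟨I, j⟩ _
    simp
  · rintro ⟨J, j⟩ _
    simp
  · rintro ⟨I, j⟩ h
    have hj : j ∈ I := by simpa using h
    simp [Finset.insert_erase hj]
  · rintro ⟨J, j⟩ h
    have hj : j ∉ J := by simpa using h
    simp [Finset.erase_insert hj]
  · rintro ⟨I, j⟩ h
    have hj : j ∈ I := by simpa using h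
    have hI : insert j (I.erase j) = I := Finset.insert_erase hj
    have hc : (I.erase j)ᶜ = insert j Iᶜ := by simp
    have hc' : (I.erase j)ᶜ.erase j = Iᶜ := by
      rw [hc, Finset.erase_insert (by simpa using hj)]
    have hs := shuffleSign_insert_mul (J := I.erase j) (K := Iᶜ) (j := j) (by simp)
      (by simpa using hj)
    rw [hI, ← hc] at hs
    simp only [hc', smul_mul_assoc, mul_smul_comm, map_smul, smul_eq_mul]
    linear_combination expect C (f (I.erase j) * g Iᶜ) * hs

/-- Families whose `I`-component acts on `H_I` only. -/
def IsLocalFamily (f : OpFamily d) : Prop := ∀ I, ∃ A : Op d I, f I = extend I A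

end OperatorFamilies

/-! ### Cochains as operator families -/

section Realization

variable {n : ℕ} {d : Fin n → ℕ} (ρ : Matrix (FullIdx d) (FullIdx d) ℂ)

/-- Scalars as a family of operators concentrated at the empty set. -/
def realizeScalar : ℂ →ₗ[ℂ] OpFamily d where
  toFun z I := if I = ∅ then z • 1 else 0
  map_add' z w := by
    funext I
    by_cases h : I = ∅ <;> simp [h, add_smul]
  map_smul' z w := by
    funext I
    by_cases h : I = ∅ <;> simp [h, mul_smul]

/-- Forms as families of operators on the full system. -/
def realizeForm (k : ℕ) : Form ρ k →ₗ[ℂ] OpFamily d where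
  toFun ω I := if h : I.card = k then extend I (ω ⟨I, h⟩ : Op d I) else 0
  map_add' ω η := by
    funext I
    by_cases h : I.card = k <;> simp [h]
  map_smul' z ω := by
    funext I
    by_cases h : I.card = k <;> simp [h]

/-- Cochains as families of operators on the full system. -/
def realize : ∀ k, Cochain ρ k →ₗ[ℂ] OpFamily d
  | 0 => realizeScalar
  | k + 1 => realizeForm ρ (k + 1)

/-- Scalars are the cochains of degree zero. -/
def scalarCochain : ℂ ≃ₗ[ℂ] Cochain ρ 0 := LinearEquiv.refl ℂ ℂ

theorem realize_scalarCochain (z : ℂ) : realize ρ 0 (scalarCochain ρ z) ∅ = z • 1 := by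
  change (if (∅ : Finset (Fin n)) = ∅ then z • (1 : Matrix (FullIdx d) _ ℂ) else 0) = z • 1
  exact if_pos rfl

theorem realizeForm_apply {k : ℕ} (ω : Form ρ k) {I : Finset (Fin n)} (h : I.card = k) :
    realizeForm ρ k ω I = extend I (ω ⟨I, h⟩ : Op d I) := dif_pos h

theorem realize_of_card_ne {k : ℕ} (ω : Cochain ρ k) {I : Finset (Fin n)} (h : I.card ≠ k) :
    realize ρ k ω I = 0 := by
  cases k with
  | zero => exact if_neg (by simpa using h)
  | succ k => exact dif_neg h

theorem isLocalFamily_realize {k : ℕ} (ω : Cochain ρ k) : IsLocalFamily (realize ρ k ω) := by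
  intro I
  by_cases h : I.card = k
  · cases k with
    | zero =>
      obtain ⟨z, rfl⟩ := (scalarCochain ρ).surjective ω
      obtain rfl := Finset.card_eq_zero.1 h
      exact ⟨z • 1, by rw [realize_scalarCochain, map_smul, extend_one]⟩
    | succ k => exact ⟨_, realizeForm_apply ρ ω h⟩
  · exact ⟨0, by rw [realize_of_card_ne ρ ω h, map_zero]⟩

/-- The nonzero factor in the degree `k` coboundary operator. -/
def coboundaryFactor : ℕ → ℂ
  | 0 => 1
  | k + 1 => ((k + 1 : ℕ) : ℂ)

theorem coboundaryFactor_ne_zero (k : ℕ) : coboundaryFactor k ≠ 0 := by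
  cases k with
  | zero => exact one_ne_zero
  | succ k => exact Nat.cast_ne_zero.2 k.succ_ne_zero

theorem extend_identitySum {k : ℕ} (ω : Form ρ k) (I : {I : Finset (Fin n) // I.card = k + 1}) :
    extend I.1 (identitySum ρ k I ω) = signedSum d (realizeForm ρ k ω) I.1 := by
  simp only [identitySum, LinearMap.coe_mk, AddHom.coe_mk]
  rw [map_sum, signedSum_apply, ← Finset.sum_coe_sort I.1]
  refine Finset.sum_congr rfl fun j _ => ?_
  rw [extend_hatTensor_one j.2, realizeForm_apply ρ ω (card_erase_eq I.2 j.2)]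

/-- X is the component of the coboundary before restriction; it is what the pairing sees. Covering
every I at once allows the pairing to be compared termwise. -/
theorem exists_realize_coboundary {k : ℕ} (ω : Cochain ρ k) (I : Finset (Fin n)) :
    ∃ X : Op d I, realize ρ (k + 1) (coboundary ρ k ω) I = extend I (restriction (reduced ρ I) X) ∧
      extend I X = coboundaryFactor k • signedSum d (realize ρ k ω) I := by
  by_cases h : I.card = k + 1
  · cases k with
    | zero =>
      obtain ⟨z, rfl⟩ := (scalarCochain ρ).surjective ω
      refine ⟨z • 1, realizeForm_apply ρ _ h, ?_⟩
      obtain ⟨a, rfl⟩ := Finset.card_eq_one.1 h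
      have ha : ({a} : Finset (Fin n)).erase a = ∅ := by simp
      rw [map_smul, extend_one, signedSum_apply, Finset.sum_singleton, ha, realize_scalarCochain]
      simp [coboundaryFactor, shuffleSign]
    | succ k =>
      refine ⟨((k + 1 : ℕ) : ℂ) • identitySum ρ (k + 1) ⟨I, h⟩ ω, realizeForm_apply ρ _ h, ?_⟩
      rw [map_smul, extend_identitySum ρ ω ⟨I, h⟩]
      rfl
  -- In the wrong cardinality δω vanishes too, since no I ∖ j has k elements.
  · refine ⟨0, by rw [realize_of_card_ne ρ _ h, map_zero, map_zero], ?_⟩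
    rw [map_zero, signedSum_apply, Finset.sum_eq_zero, smul_zero]
    intro j hj
    rw [realize_of_card_ne, smul_zero]
    intro hk
    exact h (by rw [← hk, Finset.card_erase_add_one hj])

theorem isLocalFamily_signedSum_realize {k : ℕ} (ω : Cochain ρ k) :
    IsLocalFamily (signedSum d (realize ρ k ω)) := by
  intro I
  obtain ⟨X, -, hX⟩ := exists_realize_coboundary ρ ω I
  refine ⟨(coboundaryFactor k)⁻¹ • X, ?_⟩
  rw [map_smul, hX, inv_smul_smul₀ (coboundaryFactor_ne_zero k)]

/-! ### Duality pairing of cochains -/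

variable (C : FullIdx d → ℂ)

theorem pairing_realize_coboundary_left {k : ℕ} (ω : Cochain (pureDensity C) k) {g : OpFamily d}
    (hg : IsLocalFamily g) :
    pairing C (realize _ (k + 1) (coboundary _ k ω)) g =
      coboundaryFactor k * pairing C (signedSum d (realize _ k ω)) g := by
  rw [pairing_apply, pairing_apply, Finset.mul_sum]
  refine Finset.sum_congr rfl fun I _ => ?_
  obtain ⟨X, h1, h2⟩ := exists_realize_coboundary _ ω I
  obtain ⟨B, hB⟩ := hg Iᶜ
  rw [h1, hB, expect_restriction_mul C rfl, h2, smul_mul_assoc, map_smul, smul_eq_mul,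
    mul_left_comm]

theorem pairing_realize_coboundary_right {k : ℕ} (ω : Cochain (pureDensity C) k) {f : OpFamily d}
    (hf : IsLocalFamily f) :
    pairing C f (realize _ (k + 1) (coboundary _ k ω)) =
      coboundaryFactor k * pairing C f (signedSum d (realize _ k ω)) := by
  rw [pairing_apply, pairing_apply, Finset.mul_sum]
  refine Finset.sum_congr rfl fun I _ => ?_
  obtain ⟨X, h1, h2⟩ := exists_realize_coboundary _ ω Iᶜ
  obtain ⟨A, hA⟩ := hf I
  rw [h1, hA, expect_mul_restriction C rfl, h2, mul_smul_comm, map_smul, smul_eq_mul,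
    mul_left_comm]

theorem pairing_realize_signedSum {k : ℕ} (ω : Cochain ρ k) (g : OpFamily d) :
    pairing C (signedSum d (realize ρ k ω)) g =
      (-1) ^ k * pairing C (realize ρ k ω) (signedSum d g) := by
  have h : (fun I : Finset (Fin n) => (-1 : ℂ) ^ I.card • realize ρ k ω I) =
      (-1 : ℂ) ^ k • realize ρ k ω := by
    funext I
    by_cases hI : I.card = k
    · rw [hI, Pi.smul_apply]
    · rw [Pi.smul_apply, realize_of_card_ne ρ ω hI, smul_zero, smul_zero]
  rw [pairing_signedSum, h, map_smul, LinearMap.smul_apply, smul_eq_mul]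

/-- The duality pairing of cochains. -/
def cochainPairing (k l : ℕ) :
    Cochain (pureDensity C) k →ₗ[ℂ] Module.Dual ℂ (Cochain (pureDensity C) l) :=
  (pairing C).compl₁₂ (realize _ k) (realize _ l)

theorem cochainPairing_apply {k l : ℕ} (ω : Cochain (pureDensity C) k)
    (η : Cochain (pureDensity C) l) :
    cochainPairing C k l ω η = pairing C (realize _ k ω) (realize _ l η) := rfl

theorem exists_cochainPairing_coboundary (k l : ℕ) : ∃ c : ℂ, ∀ (ω : Cochain (pureDensity C) k)
    (η : Cochain (pureDensity C) l), cochainPairing C (k + 1) l (coboundary _ k ω) η =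
      c * cochainPairing C k (l + 1) ω (coboundary _ l η) := by
  refine ⟨coboundaryFactor k * (-1) ^ k * (coboundaryFactor l)⁻¹, fun ω η => ?_⟩
  rw [cochainPairing_apply, cochainPairing_apply,
    pairing_realize_coboundary_left C ω (isLocalFamily_realize _ η),
    pairing_realize_coboundary_right C η (isLocalFamily_realize _ ω), pairing_realize_signedSum]
  field_simp [coboundaryFactor_ne_zero l]

/-- The restriction between the two coboundaries keeps δ² = 0 from applying to ω directly. Inside
the pairing both coboundaries pass to η as unrestricted sums, where δ² = 0 applies. -/
theorem cochainPairing_coboundary_coboundary {k l : ℕ} (ω : Cochain (pureDensity C) k)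
    (η : Cochain (pureDensity C) l) :
    cochainPairing C (k + 2) l (coboundary _ (k + 1) (coboundary _ k ω)) η = 0 := by
  rw [cochainPairing_apply, pairing_realize_coboundary_left C _ (isLocalFamily_realize _ η),
    pairing_realize_signedSum,
    pairing_realize_coboundary_left C ω (isLocalFamily_signedSum_realize _ η),
    pairing_realize_signedSum, signedSum_signedSum, map_zero]
  simp

variable {C}

theorem realize_mem (hC : C ≠ 0) {k : ℕ} (ω : Cochain (pureDensity C) k) {I : Finset (Fin n)}
    (h : I.card = k) :
    ∃ A ∈ restrictedOps (pureDensity C) I, realize _ k ω I = extend I A := by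
  cases k with
  | zero =>
    obtain rfl := Finset.card_eq_zero.1 h
    obtain ⟨z, rfl⟩ := (scalarCochain (pureDensity C)).surjective ω
    exact ⟨_, smul_one_mem_restrictedOps_empty hC z,
      by rw [realize_scalarCochain, map_smul, extend_one]⟩
  | succ k => exact ⟨_, Subtype.coe_prop _, realizeForm_apply _ ω h⟩

theorem exists_realize_eq {k : ℕ} {I : Finset (Fin n)} (h : I.card = k) {A : Op d I}
    (hA : A ∈ restrictedOps ρ I) :
    ∃ ω, realize ρ k ω I = extend I A ∧ ∀ J ≠ I, realize ρ k ω J = 0 := by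
  cases k with
  | zero =>
    obtain rfl := Finset.card_eq_zero.1 h
    refine ⟨scalarCochain ρ (A default default), ?_, fun J hJ => if_neg hJ⟩
    rw [realize_scalarCochain, eq_smul_one_of_op_empty A, map_smul, extend_one]
    simp
  | succ k =>
    refine ⟨(Pi.single ⟨I, h⟩ ⟨A, hA⟩ : Form ρ (k + 1)), ?_, fun J hJ => ?_⟩
    · exact (realizeForm_apply ρ _ h).trans (by rw [Pi.single_eq_same])
    · by_cases hJc : J.card = k + 1
      · refine (realizeForm_apply ρ _ hJc).trans ?_
        rw [Pi.single_eq_of_ne (by simpa using hJ)]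
        exact map_zero _
      · exact dif_neg hJc

theorem realize_injective [Nonempty (FullIdx d)] (k : ℕ) : Function.Injective (realize ρ k) := by
  rw [injective_iff_map_eq_zero]
  intro ω h
  cases k with
  | zero =>
    obtain ⟨α⟩ := ‹Nonempty (FullIdx d)›
    obtain ⟨z, rfl⟩ := (scalarCochain ρ).surjective ω
    have h' := congrFun h ∅
    rw [realize_scalarCochain] at h'
    have hz : z = 0 := by simpa using congrFun₂ h' α α
    rw [hz, map_zero]
  | succ k =>
    refine funext fun I => Subtype.ext (extend_injective I.1 ?_)
    rw [← realizeForm_apply ρ ω I.2]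
    exact (congrFun h I.1).trans (map_zero _).symm

theorem cochainPairing_injective (hC : C ≠ 0) {k l : ℕ} (hkl : k + l = n) :
    Function.Injective (cochainPairing C k l) := by
  rw [injective_iff_map_eq_zero]
  intro ω h
  have : Nonempty (FullIdx d) := ⟨(Function.ne_iff.1 hC).choose⟩
  apply realize_injective _ k
  rw [map_zero]
  funext I
  by_cases hI : I.card = k
  · obtain ⟨A, hA, hωA⟩ := realize_mem hC ω hI
    rw [hωA, eq_zero_of_expect C rfl hA, map_zero, Pi.zero_apply]
    intro B hB
    have hIc : Iᶜ.card = l := by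
      rw [Finset.card_compl, Fintype.card_fin]
      omega
    -- A test cochain concentrated at Iᶜ leaves only the I-term of the pairing.
    obtain ⟨η, hη, hη'⟩ := exists_realize_eq _ hIc hB
    have hp : cochainPairing C k l ω η = 0 := by rw [h]; rfl
    rw [cochainPairing_apply, pairing_apply, Finset.sum_eq_single I, hωA, hη] at hp
    · exact (mul_eq_zero.1 hp).resolve_left (shuffleSign_ne_zero _ _)
    · intro J _ hJ
      rw [hη' _ (compl_injective.ne hJ), mul_zero, map_zero, mul_zero]
    · simp
  · exact realize_of_card_ne _ ω hI

end Realization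

/-! ### Ranks and dimensions -/

section Dimensions

variable {n : ℕ} {d : Fin n → ℕ}

instance finiteDimensionalCochain (ρ : Matrix (FullIdx d) (FullIdx d) ℂ) :
    ∀ k, FiniteDimensional ℂ (Cochain ρ k)
  | 0 => inferInstanceAs (FiniteDimensional ℂ ℂ)
  | k + 1 => inferInstanceAs (FiniteDimensional ℂ (Form ρ (k + 1)))

theorem subsingleton_cochain (ρ : Matrix (FullIdx d) (FullIdx d) ℂ) {k : ℕ} (hk : n < k) :
    Subsingleton (Cochain ρ k) := by
  cases k with
  | zero => exact absurd hk (Nat.not_lt_zero n)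
  | succ k =>
    refine ⟨fun ω η => funext fun I => ?_⟩
    have := Finset.card_le_univ I.1
    rw [I.2, Fintype.card_fin] at this
    omega

variable {C : FullIdx d → ℂ}

theorem coboundary_coboundary (hC : C ≠ 0) (k : ℕ) (ω : Cochain (pureDensity C) k) :
    coboundary _ (k + 1) (coboundary _ k ω) = 0 := by
  by_cases hk : n < k + 2
  -- Degree k + 2 > n has no complementary degree, but its cochain space is zero.
  · have := subsingleton_cochain (pureDensity C) hk
    exact Subsingleton.elim _ _
  · apply cochainPairing_injective hC (k := k + 2) (l := n - (k + 2)) (by omega)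
    rw [map_zero]
    ext η
    exact cochainPairing_coboundary_coboundary C ω η

theorem coboundaries_le_ker (hC : C ≠ 0) (k : ℕ) :
    coboundaries (pureDensity C) k ≤ LinearMap.ker (coboundary (pureDensity C) k) := by
  cases k with
  | zero => exact bot_le
  | succ k =>
    rintro _ ⟨ω, rfl⟩
    exact coboundary_coboundary hC k ω

theorem finrank_cochain_le (hC : C ≠ 0) {k l : ℕ} (hkl : k + l = n) :
    Module.finrank ℂ (Cochain (pureDensity C) k) ≤
      Module.finrank ℂ (Cochain (pureDensity C) l) := by
  rw [← Subspace.dual_finrank_eq (K := ℂ) (V := Cochain (pureDensity C) l)]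
  exact LinearMap.finrank_le_finrank_of_injective (cochainPairing_injective hC hkl)

/-- The pairing embeds im dᵏ into the dual of Ωˡ, and adjointness puts its image inside that of the
transpose of dˡ. Exchanging k and l gives equality. -/
theorem finrank_range_coboundary_le (hC : C ≠ 0) {k l : ℕ} (hkl : k + l + 1 = n) :
    Module.finrank ℂ (LinearMap.range (coboundary (pureDensity C) k)) ≤
      Module.finrank ℂ (LinearMap.range (coboundary (pureDensity C) l)) := by
  have hinj := cochainPairing_injective hC (k := k + 1) (l := l) (by omega)
  rw [← LinearMap.finrank_range_dualMap_eq_finrank_range (coboundary (pureDensity C) l),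
    LinearEquiv.finrank_eq (Submodule.equivMapOfInjective _ hinj _)]
  apply Submodule.finrank_mono
  rintro _ ⟨_, ⟨ω, rfl⟩, rfl⟩
  obtain ⟨c, hc⟩ := exists_cochainPairing_coboundary C k l
  refine ⟨c • cochainPairing C k (l + 1) ω, ?_⟩
  ext η
  exact (hc ω η).symm

/-- For k < n this is rank dᵏ = rank dⁿ⁻ᵏ⁻¹; for k = n both sides are zero. -/
theorem finrank_range_coboundary (hC : C ≠ 0) {k : ℕ} (hk : k ≤ n) :
    Module.finrank ℂ (LinearMap.range (coboundary (pureDensity C) k)) =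
      Module.finrank ℂ (coboundaries (pureDensity C) (n - k)) := by
  rcases hk.eq_or_lt with rfl | hk
  · have := subsingleton_cochain (pureDensity C) (Nat.lt_succ_self k)
    rw [Nat.sub_self, Module.finrank_zero_of_subsingleton]
    exact (finrank_bot ℂ _).symm
  · obtain ⟨l, hl⟩ : ∃ l, n - k = l + 1 := ⟨n - k - 1, by omega⟩
    rw [hl]
    exact le_antisymm (finrank_range_coboundary_le hC (by omega))
      (finrank_range_coboundary_le hC (by omega))

theorem finrank_cohomology_add (hC : C ≠ 0) (k : ℕ) :
    Module.finrank ℂ (Cohomology (pureDensity C) k) +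
      Module.finrank ℂ (coboundaries (pureDensity C) k) +
      Module.finrank ℂ (LinearMap.range (coboundary (pureDensity C) k)) =
      Module.finrank ℂ (Cochain (pureDensity C) k) := by
  rw [← LinearMap.finrank_range_add_finrank_ker (coboundary (pureDensity C) k),
    ← Submodule.finrank_quotient_add_finrank ((coboundaries (pureDensity C) k).submoduleOf
      (LinearMap.ker (coboundary (pureDensity C) k))),
    LinearEquiv.finrank_eq (Submodule.submoduleOfEquivOfLe (coboundaries_le_ker hC k))]
  exact add_comm _ _

theorem finrank_cohomology_eq (hC : C ≠ 0) {k : ℕ} (hk : k ≤ n) :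
    Module.finrank ℂ (Cohomology (pureDensity C) k) =
      Module.finrank ℂ (Cohomology (pureDensity C) (n - k)) := by
  have h1 := finrank_cohomology_add hC k
  have h2 := finrank_cohomology_add hC (n - k)
  have h3 := finrank_range_coboundary hC hk
  have h4 := finrank_range_coboundary hC (Nat.sub_le n k)
  rw [Nat.sub_sub_self hk] at h4
  have h5 := finrank_cochain_le hC (Nat.add_sub_cancel' hk)
  have h6 := finrank_cochain_le hC (Nat.sub_add_cancel hk)
  omega

end Dimensions

end

end EntanglementCohomology

theorem mainTheorem1 {n : ℕ} {d : Fin n → ℕ} {H : Fin n → Type*}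
    [∀ i, NormedAddCommGroup (H i)] [∀ i, InnerProductSpace ℂ (H i)]
    (b : ∀ i, OrthonormalBasis (Fin (d i)) ℂ (H i)) (ψ : ⨂[ℂ] i, H i)
    (hψ : ∑ α, ‖EntanglementCohomology.stateCoeff b ψ α‖ ^ 2 = 1) (k : ℕ) (hk : k ≤ n) :
    Module.finrank ℂ (EntanglementCohomology.Cohomology
        (EntanglementCohomology.pureDensity (EntanglementCohomology.stateCoeff b ψ)) k) =
      Module.finrank ℂ (EntanglementCohomology.Cohomology
        (EntanglementCohomology.pureDensity (EntanglementCohomology.stateCoeff b ψ)) (n - k)) := by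
  refine EntanglementCohomology.finrank_cohomology_eq (fun hC => ?_) hk
  -- Of the normalization only ψ ≠ 0 is needed.
  simp [hC] at hψ
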